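/- Conventions. For $\mathbb K\in\{\mathbb R,\mathbb C\}$ equip $M_n(\mathbb K)$ with the operator norm for the standard inner product on $\mathbb K^n$, and let $M_n^s(\mathbb C)$ be the set of self-adjoint matrices in $M_n(\mathbb C)$. For a metric space $(Y,\rho)$ and a function $f$ from $Y$ to a normed space, put $L(f)=\sup\{\|f(x)-f(y)\|/\rho(x,y) : x\neq y\}\in[0,\infty]$. For compact $Y$ identify $M_n(C(Y,\mathbb K))$ with the algebra of continuous functions $Y\to M_n(\mathbb K)$, with the supremum norm $\|\cdot\|_\infty$; a projection in it is an element $p$ with $p=p^2=p^*$. For each positive integer $n$ let $\lambda_n$ be the smallest constant (the infimum of the constants) $c\ge 0$ such that, for every compact metric space $Z$, every closed subset $X\subseteq Z$, every compact space $T$, every $N\ge 0$ and every continuous $F:X\times T\to M_n^s(\mathbb C)$ with $L(F(\cdot,t))\le N$ for all $t\in T$, there is a continuous extension $G:Z\times T\to M_n^s(\mathbb C)$ of $F$ with $L(G(\cdot,t))\le cN$ for all $t\in T$ and $\|G\|_\infty=\|F\|_\infty$. Theorem 6.2. Let $Z$ be a compact metric space, $X\subseteq Z$ a closed subset with the restricted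 metric, $T$ a compact space, $n\ge 1$ an integer, and $\varepsilon>0$, $N>0$ real numbers. Suppose that $X$ is $\varepsilon$-dense in $Z$, that is, every point of $Z$ is within distance $\varepsilon$ (i.e. $\le\varepsilon$) of some point of $X$. Let $p:T\to M_n(C(X,\mathbb C))$ be continuous, such that $p_t$ is a projection and $L(p_t)\le N$ for every $t\in T$. If $\varepsilon\lambda_nN<1/12$, then there exists a continuous function $q:T\to M_n(C(Z,\mathbb C))$ such that, for every $t\in T$, $q_t$ is a projection, $q_t|_X=p_t$, and $$L(q_t)<\lambda_nN\,(1-12\,\varepsilon\lambda_nN)^{-1}.$$ The same statement, with the same constant $\lambda_n$, holds with $\mathbb R$ in place of $\mathbb C$, that is, with $M_n(C(X,\mathbb R))$ and $M_n(C(Z,\mathbb R))$. -/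

import Mathlib

open scoped NNReal ENNReal

/- The norm on square matrices over `ℝ` or `ℂ` is the operator norm coming from the Euclidean
(inner product) norm on column vectors. -/
open scoped Matrix.Norms.L2Operator

/-- The Lipschitz seminorm `L(f) = sup {‖f x - f y‖ / ρ(x, y) : x ≠ y}` of a function on a metric
space, with values in `[0, ∞]`. -/
noncomputable def lipSeminorm {Y : Type*} [MetricSpace Y] {E : Type*} [NormedAddCommGroup E]
    (f : Y → E) : ℝ≥0∞ :=
  ⨆ (x : Y) (y : Y) (_ : x ≠ y), ‖f x - f y‖ₑ / edist x y

/-- The supremum norm `sup {‖f x‖ : x}` of a function, with values in `[0, ∞]`. -/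
noncomputable def supNorm {Y : Type*} {E : Type*} [NormedAddCommGroup E] (f : Y → E) : ℝ≥0∞ :=
  ⨆ x : Y, ‖f x‖ₑ

/-- `c` is an admissible constant for parametrized Lipschitz extension of functions with values in
the self-adjoint complex `n × n` matrices: for every compact metric space `Z`, closed subset `X`
and compact parameter space `T`, every continuous `F : X × T → M_n(ℂ)` with self-adjoint values and
`L(F_t) ≤ N` for all `t` extends to a continuous `G : Z × T → M_n(ℂ)` with self-adjoint values,
`L(G_t) ≤ c N` for all `t`, and the same supremum norm.

Letting `Z` and `T` range over `Type` loses nothing: a compact metric space has at most continuum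
many points, and `T` may be replaced by the image of the map `t ↦ F_t` into `C(X, M_n(ℂ))`,
which is again a compact metric space. -/
def IsExtensionConstant (n : ℕ) (c : ℝ≥0) : Prop :=
  ∀ (Z : Type) [MetricSpace Z] [CompactSpace Z] (X : Set Z), IsClosed X →
  ∀ (T : Type) [TopologicalSpace T] [CompactSpace T] (N : ℝ≥0)
    (F : C(X × T, Matrix (Fin n) (Fin n) ℂ)),
    (∀ w, IsSelfAdjoint (F w)) →
    (∀ t : T, lipSeminorm (fun x : X => F (x, t)) ≤ N) →
    ∃ G : C(Z × T, Matrix (Fin n) (Fin n) ℂ),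
      (∀ w, IsSelfAdjoint (G w)) ∧
      (∀ (x : X) (t : T), G ((x : Z), t) = F (x, t)) ∧
      (∀ t : T, lipSeminorm (fun z : Z => G (z, t)) ≤ c * N) ∧
      supNorm G = supNorm F

/-- The constant `λ_n`: the smallest admissible constant, taken as an infimum. -/
noncomputable def extensionConstant (n : ℕ) : ℝ≥0 :=
  sInf {c : ℝ≥0 | IsExtensionConstant n c}

/-- `X` is `ε`-dense in `Z`: every point of `Z` is within distance `ε` of some point of `X`. -/
def IsEpsDense {Z : Type*} [MetricSpace Z] (ε : ℝ) (X : Set Z) : Prop :=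
  ∀ z : Z, ∃ x ∈ X, dist z x ≤ ε

/-!
A self-adjoint Lipschitz extension `G` of the family `p` exists with Lipschitz constant `K = c N`
for every `c` above the extension constant `λ`. Since `X` is `ε`-dense and `G` is a projection on
`X`, each `G (z, t)` is within `δ = ε K` of a projection, so its spectrum lies within `δ` of
`{0, 1}` and it has a spectral projection `q (z, t)` belonging to the part near `1`
(`exists_isSpectralCut`).

The main estimate is `IsSpectralCut.norm_sub_le`: if `p` and `q` are such spectral projections of
`a` and `b`, then `(1 - 2 δ) ‖p - q‖ ≤ ‖a - b‖`. Indeed `x = p (1 - q)` satisfies the Sylvester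
equation `a x - x b = p (a - b) (1 - q)`, where `‖a x‖ ≥ (1 - δ) ‖x‖` and `‖x b‖ ≤ δ ‖x‖`; and
`‖p - q‖` is the larger of `‖p (1 - q)‖` and `‖q (1 - p)‖`. This gives at once that `q` is
continuous in both variables, that it extends `p`, and that it has Lipschitz constant at most
`K / (1 - 2 ε K)`. The last is below `λ N / (1 - 12 ε λ N)` for `c` close enough to `λ`, and the
room between the two denominators absorbs the fact that the infimum `λ` may not be attained.

In the real case `G` is replaced by its average with its entrywise conjugate. Spectral cuts are
unique, so the cut of a real matrix equals its own conjugate and is real.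

Two facts on the extension constant are needed: the infimum is over a nonempty set
(`exists_isExtensionConstant`, by McShane's formula in coordinates and a radial retraction), and it
is positive (`one_le_extensionConstant`).
-/

/-! ### Spectral projections of elements close to a projection -/

section CStar

variable {A : Type*} [CStarAlgebra A]

/-- `p` is a spectral projection of `a` separating a part of the spectrum of modulus at most `δ`
from a part of modulus at least `1 - δ`. The lower bound on `a` over the range of `p` is expressed
by left multiplication on the elements `x` with `p * x = x`. -/
structure IsSpectralCut (δ : ℝ) (a p : A) : Prop where
  isStarProjection : IsStarProjection p
  commute : Commute p a
  norm_mul_one_sub_le : ‖a * (1 - p)‖ ≤ δ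
  le_norm_mul : ∀ x, p * x = x → (1 - δ) * ‖x‖ ≤ ‖a * x‖

theorem isSpectralCut_self {δ : ℝ} (hδ : 0 ≤ δ) {p : A} (hp : IsStarProjection p) :
    IsSpectralCut δ p p where
  isStarProjection := hp
  commute := Commute.refl p
  norm_mul_one_sub_le := by
    rw [mul_sub, mul_one, hp.isIdempotentElem.eq, sub_self, norm_zero]; exact hδ
  le_norm_mul x hx := by
    rw [hx]; nlinarith [norm_nonneg x]

/-- Since `a * (p * (1 - q)) - p * (1 - q) * b = p * (a - b) * (1 - q)`, the spectral gap bounds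
`p * (1 - q)`. -/
theorem IsSpectralCut.norm_mul_one_sub_le_norm_sub {δ : ℝ} {a b p q : A}
    (hp : IsSpectralCut δ a p) (hq : IsSpectralCut δ b q) :
    (1 - 2 * δ) * ‖p * (1 - q)‖ ≤ ‖a - b‖ := by
  have hpp : p * p = p := hp.isStarProjection.isIdempotentElem.eq
  have hqq : q * q = q := hq.isStarProjection.isIdempotentElem.eq
  have hq' : (1 - q) * (1 - q) = 1 - q := by rw [sub_mul, mul_sub, mul_sub, hqq]; simp
  have hcq : (1 - q) * b = b * (1 - q) := by
    rw [sub_mul, mul_sub, one_mul, mul_one, hq.commute.eq]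
  have h1 : (1 - δ) * ‖p * (1 - q)‖ ≤ ‖a * (p * (1 - q))‖ :=
    hp.le_norm_mul _ (by rw [← mul_assoc, hpp])
  have h2 : ‖p * (1 - q) * b‖ ≤ ‖p * (1 - q)‖ * δ := by
    have : p * (1 - q) * b = p * (1 - q) * (b * (1 - q)) := by
      rw [← hcq, ← mul_assoc, mul_assoc p (1 - q) (1 - q), hq']
    rw [this]
    exact (norm_mul_le _ _).trans (mul_le_mul_of_nonneg_left hq.norm_mul_one_sub_le (norm_nonneg _))
  have h3 : a * (p * (1 - q)) - p * (1 - q) * b = p * (a - b) * (1 - q) := by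
    rw [← mul_assoc, ← hp.commute.eq, mul_assoc p (1 - q) b, hcq]; noncomm_ring
  have h4 : ‖p * (a - b) * (1 - q)‖ ≤ ‖a - b‖ := by
    have e1 := hp.isStarProjection.norm_le
    have e2 := hq.isStarProjection.one_sub.norm_le
    calc ‖p * (a - b) * (1 - q)‖ ≤ ‖p‖ * ‖a - b‖ * ‖1 - q‖ :=
          (norm_mul_le _ _).trans (mul_le_mul_of_nonneg_right (norm_mul_le _ _) (norm_nonneg _))
      _ ≤ 1 * ‖a - b‖ * 1 := by gcongr
      _ = ‖a - b‖ := by ring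
  have h5 := norm_sub_norm_le (a * (p * (1 - q))) (p * (1 - q) * b)
  rw [h3] at h5
  linarith

/-- `p - q = p * (1 - q) - (1 - p) * q`, where the two summands have orthogonal ranges and
coranges. -/
theorem IsStarProjection.norm_sub_le {p q : A} (hp : IsStarProjection p) (hq : IsStarProjection q)
    {m : ℝ} (h₁ : ‖p * (1 - q)‖ ≤ m) (h₂ : ‖q * (1 - p)‖ ≤ m) : ‖p - q‖ ≤ m := by
  have hpp : p * p = p := hp.isIdempotentElem.eq
  have hqq : q * q = q := hq.isIdempotentElem.eq
  have hps : star p = p := hp.isSelfAdjoint.star_eq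
  have hqs : star q = q := hq.isSelfAdjoint.star_eq
  have hm : 0 ≤ m := (norm_nonneg _).trans h₁
  set x := p * (1 - q) with hx
  set y := (1 - p) * q with hy
  have hpp0 : p * (1 - p) = 0 := by rw [mul_sub, hpp, mul_one, sub_self]
  have hqq0 : (1 - q) * q = 0 := by rw [sub_mul, hqq, one_mul, sub_self]
  have hpp0' : (1 - p) * p = 0 := by rw [sub_mul, hpp, one_mul, sub_self]
  have hqq0' : q * (1 - q) = 0 := by rw [mul_sub, hqq, mul_one, sub_self]
  have hsx : star x = (1 - q) * p := by simp [hx, hps, hqs]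
  have hsy : star y = q * (1 - p) := by simp [hy, hps, hqs]
  have hxy : star x * y = 0 := by
    rw [hsx, hy, mul_assoc, ← mul_assoc p, hpp0, zero_mul, mul_zero]
  have hyx : star y * x = 0 := by
    rw [hsy, hx, mul_assoc, ← mul_assoc (1 - p), hpp0', zero_mul, mul_zero]
  have hxy' : x * star y = 0 := by
    rw [hsy, hx, mul_assoc, ← mul_assoc (1 - q), hqq0, zero_mul, mul_zero]
  have hyx' : y * star x = 0 := by
    rw [hsx, hy, mul_assoc, ← mul_assoc q, hqq0', zero_mul, mul_zero]
  have hd : p - q = x - y := by rw [hx, hy]; noncomm_ring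
  have hsq : star (p - q) * (p - q) = star x * x + star y * y := by
    rw [hd, star_sub, sub_mul, mul_sub, mul_sub, hxy, hyx]; simp
  have h0 : (star x * x) * (star y * y) = 0 := by
    rw [mul_assoc, ← mul_assoc x, hxy', zero_mul, mul_zero]
  have h0' : (star y * y) * (star x * x) = 0 := by
    rw [mul_assoc, ← mul_assoc y, hyx', zero_mul, mul_zero]
  have hmax := (IsSelfAdjoint.star_mul_self x).norm_add_eq_max (IsSelfAdjoint.star_mul_self y) h0
  have hynorm : ‖y‖ ≤ m := by rw [← norm_star, hsy]; exact h₂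
  have : ‖p - q‖ * ‖p - q‖ ≤ m * m := by
    rw [← CStarRing.norm_star_mul_self, hsq, hmax, CStarRing.norm_star_mul_self,
      CStarRing.norm_star_mul_self]
    exact max_le (mul_self_le_mul_self (norm_nonneg _) h₁)
      (mul_self_le_mul_self (norm_nonneg _) hynorm)
  exact abs_le_of_sq_le_sq' (by nlinarith) hm |>.2

theorem IsSpectralCut.norm_sub_le {δ : ℝ} (hδ : δ < 1 / 2) {a b p q : A}
    (hp : IsSpectralCut δ a p) (hq : IsSpectralCut δ b q) :
    ‖p - q‖ ≤ (1 - 2 * δ)⁻¹ * ‖a - b‖ := by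
  have h : 0 < 1 - 2 * δ := by linarith
  refine hp.isStarProjection.norm_sub_le hq.isStarProjection ?_ ?_
  · rw [le_inv_mul_iff₀ h]; exact hp.norm_mul_one_sub_le_norm_sub hq
  · rw [le_inv_mul_iff₀ h, norm_sub_rev]; exact hq.norm_mul_one_sub_le_norm_sub hp

theorem IsSpectralCut.unique {δ : ℝ} (hδ : δ < 1 / 2) {a p q : A}
    (hp : IsSpectralCut δ a p) (hq : IsSpectralCut δ a q) : p = q := by
  have := hp.norm_sub_le hδ hq
  rwa [sub_self, norm_zero, mul_zero, norm_le_zero_iff, sub_eq_zero] at this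

/-- The spectrum of an element within `δ` of a projection lies within `δ` of `{0, 1}`: otherwise
`r - e` is invertible with an inverse `b` such that `‖b * (a - e)‖ < 1`, and
`r - a = (r - e) * (1 - b * (a - e))` is invertible too. -/
theorem IsStarProjection.abs_le_or_abs_sub_one_le_of_mem_spectrum {e a : A}
    (he : IsStarProjection e) {δ : ℝ} (hae : ‖a - e‖ ≤ δ) {r : ℝ} (hr : r ∈ spectrum ℝ a) :
    |r| ≤ δ ∨ |r - 1| ≤ δ := by
  by_contra! h
  obtain ⟨h0, h1⟩ := h
  have hδ : 0 ≤ δ := (norm_nonneg _).trans hae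
  have hr0 : r ≠ 0 := by rintro rfl; simp at h0; linarith
  have hr1 : 1 - r ≠ 0 := by
    intro h; have : r = 1 := by linarith
    subst this; simp at h1; linarith
  have hee : e * e = e := he.isIdempotentElem.eq
  set m := min |r| |r - 1| with hm
  have hmδ : δ < m := lt_min h0 h1
  have hm0 : 0 < m := hδ.trans_lt hmδ
  -- the inverse of `r - e`
  set b : A := algebraMap ℝ A r⁻¹ * (1 - e) - algebraMap ℝ A (1 - r)⁻¹ * e with hb
  have hsub : ∀ x ∈ spectrum ℝ e, x = 0 ∨ x = 1 := fun x hx => by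
    simpa using he.isIdempotentElem.spectrum_subset ℝ hx
  have hbn : ‖b‖ ≤ m⁻¹ := by
    have : b = cfc (fun x : ℝ => r⁻¹ * (1 - x) - (1 - r)⁻¹ * x) e := by
      rw [cfc_sub .., cfc_const_mul .., cfc_const_mul .., cfc_sub .., cfc_const_one ..,
        cfc_id' ℝ e, hb, Algebra.smul_def, Algebra.smul_def]
    rw [this]
    refine norm_cfc_le (by positivity) fun x hx => ?_
    rcases hsub x hx with rfl | rfl
    · simp only [sub_zero, mul_one, mul_zero, norm_inv, Real.norm_eq_abs]
      exact inv_anti₀ hm0 (min_le_left _ _)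
    · simp only [sub_self, mul_zero, mul_one, zero_sub, norm_neg, norm_inv, Real.norm_eq_abs]
      rw [abs_sub_comm]
      exact inv_anti₀ hm0 (min_le_right _ _)
  have hR : ∀ (s : ℝ) (x : A), algebraMap ℝ A s * x = s • x := fun s x =>
    (Algebra.smul_def s x).symm
  have hbl : b * (algebraMap ℝ A r - e) = 1 := by
    rw [hb, hR, hR, Algebra.algebraMap_eq_smul_one]
    simp only [sub_mul, mul_sub, smul_mul_assoc, mul_smul_comm, one_mul, mul_one, smul_sub,
      smul_smul, hee, sub_self]
    match_scalars <;> field_simp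
    ring
  have hbr : (algebraMap ℝ A r - e) * b = 1 := by
    rw [hb, hR, hR, Algebra.algebraMap_eq_smul_one]
    simp only [sub_mul, mul_sub, smul_mul_assoc, mul_smul_comm, one_mul, mul_one, smul_sub,
      smul_smul, hee]
    match_scalars <;> field_simp
    ring
  refine hr ?_
  have hu : IsUnit (1 - b * (a - e)) := by
    refine isUnit_one_sub_of_norm_lt_one ((norm_mul_le _ _).trans_lt ?_)
    calc ‖b‖ * ‖a - e‖ ≤ m⁻¹ * δ := by gcongr
      _ < m⁻¹ * m := by gcongr
      _ = 1 := inv_mul_cancel₀ hm0.ne'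
  have : algebraMap ℝ A r - a = (algebraMap ℝ A r - e) * (1 - b * (a - e)) := by
    rw [mul_sub, ← mul_assoc, hbr]; noncomm_ring
  rw [spectrum.mem_resolventSet_iff, this]
  exact IsUnit.mul ⟨⟨_, b, hbr, hbl⟩, rfl⟩ hu

/-- The projection is the continuous functional calculus of `a` at a piecewise linear function that
vanishes on `(-∞, δ]` and equals `1` on `[1 - δ, ∞)`. -/
theorem exists_isSpectralCut {δ : ℝ} (hδ : δ < 1 / 2) {a e : A} (ha : IsSelfAdjoint a)
    (he : IsStarProjection e) (hae : ‖a - e‖ ≤ δ) : ∃ p, IsSpectralCut δ a p := by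
  have hδ0 : 0 ≤ δ := (norm_nonneg _).trans hae
  have hg : 0 < 1 - 2 * δ := by linarith
  obtain ⟨f, hfc, hf0, hf1⟩ : ∃ f : ℝ → ℝ, Continuous f ∧ (∀ x ≤ δ, f x = 0) ∧
      ∀ x, 1 - δ ≤ x → f x = 1 := by
    refine ⟨fun x => max 0 (min 1 ((x - δ) / (1 - 2 * δ))), by fun_prop, fun x hx => ?_,
      fun x hx => ?_⟩
    · exact max_eq_left ((min_le_right _ _).trans
        (div_nonpos_of_nonpos_of_nonneg (by linarith) hg.le))
    · have h1 : 1 ≤ (x - δ) / (1 - 2 * δ) := by rw [le_div_iff₀ hg]; linarith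
      simp only [min_eq_left h1]; norm_num
  have hspec : ∀ x ∈ spectrum ℝ a, (|x| ≤ δ ∧ f x = 0) ∨ (1 - δ ≤ x ∧ f x = 1) := by
    intro x hx
    rcases he.abs_le_or_abs_sub_one_le_of_mem_spectrum hae hx with h | h
    · exact Or.inl ⟨h, hf0 x (abs_le.1 h).2⟩
    · have : 1 - δ ≤ x := by linarith [(abs_le.1 h).1]
      exact Or.inr ⟨this, hf1 x this⟩
  have hfa : ContinuousOn f (spectrum ℝ a) := hfc.continuousOn
  -- `cfc g a` inverts `a` on the range of `cfc f a`
  obtain ⟨g, hg⟩ : ∃ g : ℝ → ℝ, g = fun x => f x * (max x (1 - δ))⁻¹ := ⟨_, rfl⟩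
  have hmax : ∀ x, 0 < max x (1 - δ) := fun x => lt_max_of_lt_right (by linarith)
  have hga : ContinuousOn g (spectrum ℝ a) := by
    rw [hg]
    exact (hfc.mul ((continuous_id.max continuous_const).inv₀ fun x => (hmax x).ne')).continuousOn
  have hr : ‖cfc g a‖ ≤ (1 - δ)⁻¹ := by
    refine norm_cfc_le (by rw [inv_nonneg]; linarith) fun x hx => ?_
    rcases hspec x hx with ⟨-, h⟩ | ⟨h1, h⟩
    · simp only [hg, h, zero_mul, norm_zero, inv_nonneg]; linarith
    · simp only [hg, h, one_mul, norm_inv, Real.norm_eq_abs, abs_of_pos (hmax x)]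
      exact inv_anti₀ (by linarith) (le_max_right _ _)
  have hrp : cfc g a * a = cfc f a := by
    have : cfc g a * a = cfc (fun x => g x * x) a := by
      rw [cfc_mul g (fun x => x) a hga continuousOn_id, cfc_id' ℝ a]
    rw [this]
    refine cfc_congr fun x hx => ?_
    rcases hspec x hx with ⟨-, h⟩ | ⟨h1, h⟩
    · simp [hg, h]
    · have : x ≠ 0 := by intro h; linarith
      simp [hg, h, max_eq_left h1, this]
  have hcomm : Commute (cfc f a) a := by
    simpa only [cfc_id ℝ a] using cfc_commute_cfc f id a
  refine ⟨cfc f a, ⟨?_, cfc_predicate f a⟩, hcomm, ?_, ?_⟩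
  · rw [IsIdempotentElem, ← cfc_mul f f a hfa hfa]
    refine cfc_congr fun x hx => ?_
    rcases hspec x hx with ⟨-, h⟩ | ⟨h1, h⟩ <;> simp [h]
  · have : a * (1 - cfc f a) = cfc (fun x => x * (1 - f x)) a := by
      rw [cfc_mul (fun x => x) (fun x => 1 - f x) a continuousOn_id (continuousOn_const.sub hfa),
        cfc_sub (fun _ => 1) f a continuousOn_const hfa, cfc_const_one ℝ a, cfc_id' ℝ a]
    rw [this]
    refine norm_cfc_le hδ0 fun x hx => ?_
    rcases hspec x hx with ⟨h', h⟩ | ⟨h1, h⟩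
    · simpa [h] using h'
    · simpa [h] using hδ0
  · intro x hx
    have hx' : x = cfc g a * (a * x) := by rw [← mul_assoc, hrp, hx]
    have h1 : 0 < 1 - δ := by linarith
    rw [← le_inv_mul_iff₀ h1]
    calc ‖x‖ = ‖cfc g a * (a * x)‖ := by rw [← hx']
      _ ≤ ‖cfc g a‖ * ‖a * x‖ := norm_mul_le _ _
      _ ≤ _ := by gcongr

end CStar

/-! ### Lipschitz extension with parameters -/

section Lipschitz

theorem lipSeminorm_le_iff {Y : Type*} [MetricSpace Y] {E : Type*} [NormedAddCommGroup E]
    {f : Y → E} {K : ℝ≥0} : lipSeminorm f ≤ K ↔ LipschitzWith K f := by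
  simp only [lipSeminorm, iSup_le_iff, LipschitzWith, edist_eq_enorm_sub (f _)]
  refine forall₂_congr fun x y => ?_
  by_cases h : x = y
  · subst h; simp
  · rw [ENNReal.div_le_iff (by simpa [edist_eq_zero] using h) (edist_ne_top x y)]
    simp [h]

/-- McShane's extension `z ↦ inf_x (F (x, t) + K ρ(x, z))`, jointly continuous in `z` and the
parameter `t`. -/
theorem exists_continuousMap_extension_real {Z T : Type*} [MetricSpace Z] [CompactSpace Z]
    {X : Set Z} (hX : IsClosed X) [TopologicalSpace T] {K : ℝ≥0} (F : C(X × T, ℝ))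
    (hF : ∀ t, LipschitzWith K fun x => F (x, t)) :
    ∃ G : C(Z × T, ℝ), (∀ (x : X) t, G (x, t) = F (x, t)) ∧
      ∀ t, LipschitzWith K fun z => G (z, t) := by
  have : CompactSpace X := isCompact_iff_compactSpace.1 hX.isCompact
  rcases isEmpty_or_nonempty X with hXe | hXe
  · exact ⟨0, fun x => hXe.elim x, fun t => by simpa using LipschitzWith.const' (0 : ℝ)⟩
  let f : C(T, C(X, ℝ)) := (F.comp ContinuousMap.prodSwap).curry
  have hf : ∀ x t, F (x, t) = f t x := fun x t => rfl
  let g : Z → T → ℝ := fun z t => ⨅ x : X, (F (x, t) + K * dist z x)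
  have hbdd : ∀ (z : Z) (t : T), BddBelow (Set.range fun x : X => F (x, t) + K * dist z x) :=
    fun z t => (isCompact_range (by fun_prop)).bddBelow
  have key : ∀ z w t s, g z t ≤ g w s + (K * dist z w + dist (f t) (f s)) := by
    intro z w t s
    rw [← sub_le_iff_le_add]
    refine le_ciInf fun x => ?_
    rw [sub_le_iff_le_add]
    refine (ciInf_le (hbdd z t) x).trans ?_
    have h1 : dist z x ≤ dist z w + dist w x := dist_triangle _ _ _
    have h2 := (le_abs_self _).trans ((f t).dist_apply_le_dist (g := f s) x)
    simp only [hf]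
    nlinarith [K.2]
  have key' : ∀ z w t s, dist (g z t) (g w s) ≤ K * dist z w + dist (f t) (f s) := by
    intro z w t s
    rw [Real.dist_eq, abs_sub_le_iff]
    have h1 := key z w t s
    have h2 := key w z s t
    rw [dist_comm w z, dist_comm (f s)] at h2
    constructor <;> linarith
  have hcont : Continuous fun w : Z × T => g w.1 w.2 := by
    rw [continuous_iff_continuousAt]
    intro w
    rw [ContinuousAt, tendsto_iff_dist_tendsto_zero]
    refine squeeze_zero (fun _ => dist_nonneg) (fun v => key' v.1 w.1 v.2 w.2) ?_
    have : Continuous fun v : Z × T => K * dist v.1 w.1 + dist (f v.2) (f w.2) := by fun_prop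
    simpa using this.tendsto w
  refine ⟨⟨_, hcont⟩, fun x t => ?_, fun t => LipschitzWith.of_dist_le_mul fun z w => ?_⟩
  · refine le_antisymm ((ciInf_le (hbdd x t) x).trans (by simp)) (le_ciInf fun y => ?_)
    have := (le_abs_self _).trans ((hF t).dist_le_mul x y)
    rw [Subtype.dist_eq] at this
    linarith
  · simpa using key' z w t t

/-- The constant obtained by extending coordinates is not sharp; only its finiteness matters. -/
theorem exists_forall_continuousMap_extension (E : Type*) [NormedAddCommGroup E]
    [NormedSpace ℝ E] [FiniteDimensional ℝ E] :
    ∃ C : ℝ≥0, ∀ (Z T : Type) [MetricSpace Z] [CompactSpace Z] (X : Set Z) (_ : IsClosed X)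
      [TopologicalSpace T] (K : ℝ≥0) (F : C(X × T, E)),
      (∀ t, LipschitzWith K fun x => F (x, t)) →
      ∃ G : C(Z × T, E), (∀ (x : X) t, G (x, t) = F (x, t)) ∧
        ∀ t, LipschitzWith (C * K) fun z => G (z, t) := by
  let e : E ≃L[ℝ] (Fin (Module.finrank ℝ E) → ℝ) := ContinuousLinearEquiv.ofFinrankEq (by simp)
  let e₁ : E →L[ℝ] (Fin (Module.finrank ℝ E) → ℝ) := e
  let e₂ : (Fin (Module.finrank ℝ E) → ℝ) →L[ℝ] E := e.symm
  refine ⟨‖e₂‖₊ * ‖e₁‖₊, fun Z T _ _ X hX _ K F hF => ?_⟩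
  have hi : ∀ i, ∃ G : C(Z × T, ℝ), (∀ (x : X) t, G (x, t) = e (F (x, t)) i) ∧
      ∀ t, LipschitzWith (‖e₁‖₊ * K) fun z => G (z, t) := fun i =>
    exists_continuousMap_extension_real hX ⟨fun w => e (F w) i, by fun_prop⟩ fun t => by
      have := (LipschitzWith.eval i).comp (e₁.lipschitz.comp (hF t))
      rw [one_mul] at this
      exact this
  choose G hG hGL using hi
  refine ⟨⟨fun w => e.symm fun i => G i w, by fun_prop⟩, fun x t => ?_, fun t => ?_⟩
  · simp [hG]
  · have : LipschitzWith (‖e₁‖₊ * K) fun z i => G i (z, t) :=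
      fun z w => edist_pi_le_iff.2 fun i => hGL i t z w
    have := e₂.lipschitz.comp this
    rw [mul_assoc]
    exact this

/-- The radial retraction onto the ball of radius `R`. -/
noncomputable def radialRetraction {E : Type*} [NormedAddCommGroup E] [NormedSpace ℝ E] (R : ℝ)
    (v : E) : E := (R / max R ‖v‖) • v

section Radial

variable {E : Type*} [NormedAddCommGroup E] [NormedSpace ℝ E]

theorem norm_radialRetraction_le {R : ℝ} (hR : 0 ≤ R) (v : E) : ‖radialRetraction R v‖ ≤ R := by
  rw [radialRetraction, norm_smul, Real.norm_eq_abs, abs_of_nonneg (by positivity),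
    div_mul_eq_mul_div]
  refine div_le_of_le_mul₀ (le_max_of_le_left hR) hR ?_
  gcongr
  exact le_max_right _ _

theorem radialRetraction_eq_self {R : ℝ} {v : E} (hv : ‖v‖ ≤ R) : radialRetraction R v = v := by
  rw [radialRetraction, max_eq_left hv]
  rcases eq_or_ne R 0 with rfl | h
  · simp [norm_le_zero_iff.1 hv]
  · rw [div_self h, one_smul]

theorem lipschitzWith_radialRetraction {R : ℝ} (hR : 0 ≤ R) :
    LipschitzWith 2 (radialRetraction R : E → E) := by
  rcases hR.eq_or_lt with rfl | hR
  · have : (radialRetraction 0 : E → E) = fun _ => 0 := by funext v; simp [radialRetraction]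
    rw [this]; exact LipschitzWith.const' 0
  refine LipschitzWith.of_dist_le_mul fun v w => ?_
  rw [dist_eq_norm, dist_eq_norm]
  set a := max R ‖v‖ with ha
  set b := max R ‖w‖ with hb
  have ha0 : 0 < a := lt_max_of_lt_left hR
  have hb0 : 0 < b := lt_max_of_lt_left hR
  have hRa : R / a ≤ 1 := (div_le_one ha0).2 (le_max_left _ _)
  have hwb : ‖w‖ / b ≤ 1 := (div_le_one hb0).2 (le_max_right _ _)
  have hab : |b - a| ≤ ‖v - w‖ := by
    rw [hb, ha]
    refine (abs_max_sub_max_le_max _ _ _ _).trans ?_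
    rw [sub_self, abs_zero, max_eq_right (abs_nonneg _), norm_sub_rev]
    exact abs_norm_sub_norm_le _ _
  have h : radialRetraction R v - radialRetraction R w
      = (R / a) • (v - w) + ((R / a) * (b - a) / b) • w := by
    rw [radialRetraction, radialRetraction, ← ha, ← hb]
    match_scalars <;> field_simp
    ring
  rw [h]
  calc _ ≤ ‖(R / a) • (v - w)‖ + ‖((R / a) * (b - a) / b) • w‖ := norm_add_le _ _
    _ = R / a * ‖v - w‖ + R / a * |b - a| * (‖w‖ / b) := by
      rw [norm_smul, norm_smul, norm_div (_ * _), norm_mul (R / a)]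
      simp only [Real.norm_eq_abs, abs_of_pos hb0, abs_of_pos (div_pos hR ha0)]
      ring
    _ ≤ 1 * ‖v - w‖ + 1 * ‖v - w‖ * 1 := by gcongr
    _ = _ := by rw [NNReal.coe_ofNat]; ring

end Radial

theorem exists_isExtensionConstant (n : ℕ) : ∃ c, IsExtensionConstant n c := by
  obtain ⟨C, hC⟩ := exists_forall_continuousMap_extension (Matrix (Fin n) (Fin n) ℂ)
  refine ⟨2 * C, fun Z _ _ X hX T _ _ N F hFs hF => ?_⟩
  have : CompactSpace X := isCompact_iff_compactSpace.1 hX.isCompact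
  obtain ⟨G, hG, hGL⟩ := hC Z T X hX N F fun t => lipSeminorm_le_iff.1 (hF t)
  have hLs : LipschitzWith 1 fun v : Matrix (Fin n) (Fin n) ℂ => (2⁻¹ : ℝ) • (v + star v) := by
    refine LipschitzWith.of_dist_le_mul fun v w => ?_
    have : (2⁻¹ : ℝ) • (v + star v) - (2⁻¹ : ℝ) • (w + star w)
        = (2⁻¹ : ℝ) • ((v - w) + star (v - w)) := by rw [star_sub]; module
    rw [dist_eq_norm, dist_eq_norm, this, norm_smul]
    have := norm_add_le (v - w) (star (v - w))
    rw [norm_star] at this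
    simp only [norm_inv, Real.norm_ofNat, NNReal.coe_one, one_mul]
    linarith
  have hLr := lipschitzWith_radialRetraction (E := Matrix (Fin n) (Fin n) ℂ) (norm_nonneg F)
  let S : C(Z × T, Matrix (Fin n) (Fin n) ℂ) :=
    ⟨fun w => radialRetraction ‖F‖ ((2⁻¹ : ℝ) • (G w + star (G w))),
      hLr.continuous.comp (hLs.continuous.comp G.continuous)⟩
  have hS : ∀ w, S w = radialRetraction ‖F‖ ((2⁻¹ : ℝ) • (G w + star (G w))) := fun w => rfl
  have hSF : ∀ (x : X) (t : T), S ((x : Z), t) = F (x, t) := fun x t => by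
    have : (2⁻¹ : ℝ) • (F (x, t) + F (x, t)) = F (x, t) := by module
    rw [hS, hG, (hFs _).star_eq, this, radialRetraction_eq_self (F.norm_coe_le_norm _)]
  refine ⟨S, fun w => ?_, hSF, fun t => ?_, le_antisymm (iSup_le fun w => ?_) (iSup_le fun w => ?_)⟩
  · rw [hS, radialRetraction]
    refine (IsSelfAdjoint.all _).smul ((IsSelfAdjoint.all _).smul ?_)
    exact IsSelfAdjoint.add_star_self _
  · have := lipSeminorm_le_iff.2 (hLr.comp (hLs.comp (hGL t)))
    rw [← ENNReal.coe_mul]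
    have hc : 2 * C * N = 2 * (1 * (C * N)) := by ring
    rw [hc]
    exact this
  · have hfin : supNorm F ≠ ⊤ :=
      ne_top_of_le_ne_top enorm_ne_top (iSup_le fun w => by
        rw [enorm_le_iff_norm_le]; exact F.norm_coe_le_norm w : supNorm F ≤ ‖F‖ₑ)
    have h1 : ‖F‖ ≤ (supNorm F).toReal := by
      rw [F.norm_le ENNReal.toReal_nonneg]
      intro w
      rw [← toReal_enorm]
      exact ENNReal.toReal_mono hfin (le_iSup (fun w => ‖F w‖ₑ) w)
    rw [← ofReal_norm]
    exact ENNReal.ofReal_le_of_le_toReal ((norm_radialRetraction_le (norm_nonneg F) _).trans h1)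
  · exact (congrArg _ (hSF w.1 w.2)).symm.le.trans (le_iSup (fun w => ‖S w‖ₑ) ((w.1 : Z), w.2))

theorem IsExtensionConstant.mono {n : ℕ} {c d : ℝ≥0} (h : IsExtensionConstant n c) (hcd : c ≤ d) :
    IsExtensionConstant n d := by
  intro Z _ _ X hX T _ _ N F hFs hF
  obtain ⟨G, h1, h2, h3, h4⟩ := h Z X hX T N F hFs hF
  exact ⟨G, h1, h2, fun t => (h3 t).trans (by gcongr), h4⟩

theorem isExtensionConstant_of_lt {n : ℕ} {c : ℝ≥0} (h : extensionConstant n < c) :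
    IsExtensionConstant n c := by
  obtain ⟨d, hd, hdc⟩ := exists_lt_of_csInf_lt (exists_isExtensionConstant n) h
  exact IsExtensionConstant.mono hd hdc.le

/-- On a two-point space that is its own closed subset, the extension is the function itself. -/
theorem one_le_extensionConstant {n : ℕ} (hn : 0 < n) : 1 ≤ extensionConstant n := by
  have : NeZero n := ⟨hn.ne'⟩
  refine le_csInf (exists_isExtensionConstant n) fun c hc => ?_
  have hXc : IsClosed ({0, 1} : Set ℝ) := (Set.toFinite _).isClosed
  have : CompactSpace ({0, 1} : Set ℝ) :=
    isCompact_iff_compactSpace.1 (Set.toFinite ({0, 1} : Set ℝ)).isCompact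
  have hL : LipschitzWith 1 fun x : ℝ => x • (1 : Matrix (Fin n) (Fin n) ℂ) :=
    LipschitzWith.of_dist_le_mul fun x y => by
      rw [dist_eq_norm, ← sub_smul, norm_smul, norm_one, dist_eq_norm]; simp
  obtain ⟨G, -, h2, h3, -⟩ := hc ({0, 1} : Set ℝ) Set.univ isClosed_univ Unit 1
    ⟨fun w => ((w.1 : ({0, 1} : Set ℝ)) : ℝ) • 1, by fun_prop⟩
    (fun w => (IsSelfAdjoint.all _).smul (IsSelfAdjoint.one _))
    (fun t => lipSeminorm_le_iff.2
      (((hL.comp (LipschitzWith.subtype_val _)).comp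
        (LipschitzWith.subtype_val (Set.univ : Set ({0, 1} : Set ℝ)))).weaken (by simp)))
  have h3 := h3 ()
  rw [← ENNReal.coe_mul, lipSeminorm_le_iff, mul_one] at h3
  have h := h3.dist_le_mul ⟨0, by simp⟩ ⟨1, by simp⟩
  have e0 := h2 ⟨⟨0, by simp⟩, trivial⟩ ()
  have e1 := h2 ⟨⟨1, by simp⟩, trivial⟩ ()
  simp only at e0 e1
  rw [e0, e1] at h
  simpa [dist_eq_norm, Subtype.dist_eq] using h

/-- The spaces in the definition of an extension constant live in `Type`; the general case follows
by replacing `Z` by its image under the Kuratowski embedding, and `T` by the range of `p` in the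
space of continuous functions. -/
theorem IsExtensionConstant.exists_extension {n : ℕ} {c : ℝ≥0} (h : IsExtensionConstant n c)
    {Z T : Type*} [MetricSpace Z] [CompactSpace Z] {X : Set Z} (hX : IsClosed X)
    [TopologicalSpace T] [CompactSpace T] {N : ℝ≥0} {p : T → C(X, Matrix (Fin n) (Fin n) ℂ)}
    (hp : Continuous p) (hps : ∀ t x, IsSelfAdjoint (p t x)) (hpL : ∀ t, LipschitzWith N (p t)) :
    ∃ G : C(Z × T, Matrix (Fin n) (Fin n) ℂ), (∀ w, IsSelfAdjoint (G w)) ∧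
      (∀ (x : X) t, G (x, t) = p t x) ∧ ∀ t, LipschitzWith (c * N) fun z => G (z, t) := by
  have : CompactSpace X := isCompact_iff_compactSpace.1 hX.isCompact
  have hk := kuratowskiEmbedding.isometry Z
  let Z' := Set.range (kuratowskiEmbedding Z)
  let e : Z ≃ᵢ Z' := hk.isometryEquivOnRange
  have : CompactSpace Z' := isCompact_iff_compactSpace.1 (isCompact_range hk.continuous)
  let X' : Set Z' := e.symm ⁻¹' X
  have hX' : IsClosed X' := hX.preimage e.symm.continuous
  have : CompactSpace X' := isCompact_iff_compactSpace.1 hX'.isCompact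
  let r : C(X', X) := ⟨fun x => ⟨e.symm x, x.2⟩, by fun_prop⟩
  let p' : T → C(X', Matrix (Fin n) (Fin n) ℂ) := fun t => (p t).comp r
  have hp' : Continuous p' := (ContinuousMap.continuous_precomp r).comp hp
  have : CompactSpace (Set.range p') := isCompact_iff_compactSpace.1 (isCompact_range hp')
  obtain ⟨G, h1, h2, h3, -⟩ := h Z' X' hX' (Set.range p') N
    ⟨fun w => (w.2 : C(X', Matrix (Fin n) (Fin n) ℂ)) w.1, by fun_prop⟩
    (by rintro ⟨x, _, t, rfl⟩; exact hps _ _)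
    (by
      rintro ⟨_, t, rfl⟩
      refine lipSeminorm_le_iff.2 (LipschitzWith.of_dist_le_mul fun x y => ?_)
      refine ((hpL t).dist_le_mul _ _).trans (le_of_eq ?_)
      congr 1
      exact e.symm.dist_eq _ _)
  refine ⟨⟨fun w => G (e w.1, ⟨p' w.2, w.2, rfl⟩), by fun_prop⟩, fun w => h1 _,
    fun x t => ?_, fun t => ?_⟩
  · have := h2 ⟨e x, by simp [X']⟩ ⟨p' t, t, rfl⟩
    simp only [ContinuousMap.coe_mk] at this ⊢
    rw [this]
    simp [p', r]
  · have := (lipSeminorm_le_iff.1 ((h3 ⟨p' t, t, rfl⟩).trans_eq (ENNReal.coe_mul _ _).symm)).comp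
      e.isometry.lipschitz
    rw [mul_one] at this
    exact this

end Lipschitz

/-! ### Real matrices inside complex matrices -/

section RealStructure

variable {n : ℕ}

theorem sum_norm_sq_mulVec_le {𝕜 : Type*} [RCLike 𝕜] (A : Matrix (Fin n) (Fin n) 𝕜)
    (v : Fin n → 𝕜) : ∑ i, ‖(A.mulVec v) i‖ ^ 2 ≤ ‖A‖ ^ 2 * ∑ i, ‖v i‖ ^ 2 := by
  have h := pow_le_pow_left₀ (norm_nonneg _) (A.l2_opNorm_mulVec (WithLp.toLp 2 v)) 2
  rw [mul_pow, EuclideanSpace.norm_sq_eq, EuclideanSpace.norm_sq_eq] at h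
  exact h

theorem l2_opNorm_le_of_sum_norm_sq_mulVec_le {𝕜 : Type*} [RCLike 𝕜]
    {A : Matrix (Fin n) (Fin n) 𝕜} {C : ℝ} (hC : 0 ≤ C)
    (h : ∀ v : Fin n → 𝕜, ∑ i, ‖(A.mulVec v) i‖ ^ 2 ≤ C ^ 2 * ∑ i, ‖v i‖ ^ 2) : ‖A‖ ≤ C := by
  rw [← Matrix.l2_opNorm_toEuclideanCLM]
  refine ContinuousLinearMap.opNorm_le_bound _ hC fun v => ?_
  refine (pow_le_pow_iff_left₀ (norm_nonneg _) (by positivity) two_ne_zero).1 ?_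
  rw [mul_pow, EuclideanSpace.norm_sq_eq, EuclideanSpace.norm_sq_eq]
  simpa using h v

/-- Entrywise complex conjugation of matrices. -/
noncomputable def matrixConj : Matrix (Fin n) (Fin n) ℂ →+* Matrix (Fin n) (Fin n) ℂ :=
  (starRingEnd ℂ).mapMatrix

/-- The inclusion of the real matrices in the complex matrices. -/
noncomputable def matrixOfReal : Matrix (Fin n) (Fin n) ℝ →+* Matrix (Fin n) (Fin n) ℂ :=
  Complex.ofRealHom.mapMatrix

theorem matrixConj_apply (A : Matrix (Fin n) (Fin n) ℂ) (i j : Fin n) :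
    matrixConj A i j = starRingEnd ℂ (A i j) := rfl

theorem matrixOfReal_apply (A : Matrix (Fin n) (Fin n) ℝ) (i j : Fin n) :
    matrixOfReal A i j = A i j := rfl

@[simp]
theorem matrixConj_matrixConj (A : Matrix (Fin n) (Fin n) ℂ) : matrixConj (matrixConj A) = A := by
  ext i j; simp [matrixConj_apply]

theorem matrixConj_star (A : Matrix (Fin n) (Fin n) ℂ) :
    matrixConj (star A) = star (matrixConj A) := by
  ext i j; simp [matrixConj_apply]

theorem matrixConj_real_smul (r : ℝ) (A : Matrix (Fin n) (Fin n) ℂ) :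
    matrixConj (r • A) = r • matrixConj A := by
  ext i j; simp [matrixConj_apply]

@[simp]
theorem matrixConj_matrixOfReal (A : Matrix (Fin n) (Fin n) ℝ) :
    matrixConj (matrixOfReal A) = matrixOfReal A := by
  ext i j; simp [matrixConj_apply, matrixOfReal_apply]

theorem matrixOfReal_star (A : Matrix (Fin n) (Fin n) ℝ) :
    matrixOfReal (star A) = star (matrixOfReal A) := by
  ext i j; simp [matrixOfReal_apply]

theorem matrixOfReal_injective :
    Function.Injective (matrixOfReal : Matrix (Fin n) (Fin n) ℝ → _) := by
  intro A B h
  ext i j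
  have := congrFun (congrFun h i) j
  simpa [matrixOfReal_apply] using this

theorem matrixOfReal_map_re {A : Matrix (Fin n) (Fin n) ℂ} (hA : matrixConj A = A) :
    matrixOfReal (A.map Complex.re) = A := by
  ext i j
  have := congrFun (congrFun hA i) j
  rw [matrixConj_apply] at this
  exact Complex.conj_eq_iff_re.1 this

theorem norm_matrixConj (A : Matrix (Fin n) (Fin n) ℂ) : ‖matrixConj A‖ = ‖A‖ := by
  have key : ∀ A : Matrix (Fin n) (Fin n) ℂ, ‖matrixConj A‖ ≤ ‖A‖ := fun A => by
    refine l2_opNorm_le_of_sum_norm_sq_mulVec_le (norm_nonneg _) fun v => ?_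
    have h := sum_norm_sq_mulVec_le A fun i => starRingEnd ℂ (v i)
    have e : ∀ i, (A.mulVec fun i => starRingEnd ℂ (v i)) i
        = starRingEnd ℂ ((matrixConj A).mulVec v i) := fun i => by
      simp [Matrix.mulVec, dotProduct, matrixConj_apply]
    simpa [e] using h
  exact le_antisymm (key A) (by simpa using key (matrixConj A))

theorem norm_matrixOfReal (A : Matrix (Fin n) (Fin n) ℝ) : ‖matrixOfReal A‖ = ‖A‖ := by
  refine le_antisymm (l2_opNorm_le_of_sum_norm_sq_mulVec_le (norm_nonneg _) fun v => ?_)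
    (l2_opNorm_le_of_sum_norm_sq_mulVec_le (norm_nonneg _) fun v => ?_)
  · have h1 := sum_norm_sq_mulVec_le A fun i => (v i).re
    have h2 := sum_norm_sq_mulVec_le A fun i => (v i).im
    have e : ∀ z : ℂ, ‖z‖ ^ 2 = ‖z.re‖ ^ 2 + ‖z.im‖ ^ 2 := fun z => by
      rw [Complex.sq_norm, Complex.normSq_apply, Real.norm_eq_abs, Real.norm_eq_abs, sq_abs,
        sq_abs, sq, sq]
    have e1 : ∀ i, ((matrixOfReal A).mulVec v i).re = A.mulVec (fun i => (v i).re) i :=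
      fun i => by simp [Matrix.mulVec, dotProduct, matrixOfReal_apply]
    have e2 : ∀ i, ((matrixOfReal A).mulVec v i).im = A.mulVec (fun i => (v i).im) i :=
      fun i => by simp [Matrix.mulVec, dotProduct, matrixOfReal_apply]
    simp only [e, e1, e2, Finset.sum_add_distrib, mul_add]
    exact add_le_add h1 h2
  · have h := sum_norm_sq_mulVec_le (matrixOfReal A) fun i => (v i : ℂ)
    have e : ∀ i, ((matrixOfReal A).mulVec fun i => (v i : ℂ)) i = (A.mulVec v i : ℝ) :=
      fun i => by simp [Matrix.mulVec, dotProduct, matrixOfReal_apply]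
    simpa [e] using h

theorem isometry_matrixOfReal : Isometry (matrixOfReal : Matrix (Fin n) (Fin n) ℝ → _) :=
  Isometry.of_dist_eq fun A B => by
    rw [dist_eq_norm, ← map_sub, norm_matrixOfReal, dist_eq_norm]

theorem isometry_matrixConj :
    Isometry (matrixConj : Matrix (Fin n) (Fin n) ℂ → Matrix (Fin n) (Fin n) ℂ) :=
  Isometry.of_dist_eq fun A B => by
    rw [dist_eq_norm, ← map_sub, norm_matrixConj, dist_eq_norm]

theorem isStarProjection_matrixOfReal_iff {A : Matrix (Fin n) (Fin n) ℝ} :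
    IsStarProjection (matrixOfReal A) ↔ IsStarProjection A := by
  rw [isStarProjection_iff, isStarProjection_iff, IsIdempotentElem, IsIdempotentElem, ← map_mul,
    matrixOfReal_injective.eq_iff, IsSelfAdjoint, IsSelfAdjoint, ← matrixOfReal_star,
    matrixOfReal_injective.eq_iff]

theorem IsSpectralCut.matrixConj {δ : ℝ} {a p : Matrix (Fin n) (Fin n) ℂ}
    (h : IsSpectralCut δ a p) : IsSpectralCut δ (matrixConj a) (matrixConj p) where
  isStarProjection := by
    refine ⟨?_, ?_⟩
    · rw [IsIdempotentElem, ← map_mul, h.isStarProjection.isIdempotentElem.eq]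
    · rw [IsSelfAdjoint, ← matrixConj_star, h.isStarProjection.isSelfAdjoint.star_eq]
  commute := h.commute.map _
  norm_mul_one_sub_le := by
    rw [← map_one _root_.matrixConj, ← map_sub, ← map_mul, norm_matrixConj]
    exact h.norm_mul_one_sub_le
  le_norm_mul x hx := by
    have := h.le_norm_mul (_root_.matrixConj x) (by
      conv_rhs => rw [← hx, map_mul, matrixConj_matrixConj])
    rwa [norm_matrixConj, ← norm_matrixConj (a * _), map_mul, matrixConj_matrixConj] at this

end RealStructure

/-! ### Extension of projections -/

section Extension

variable {Z T : Type*} [MetricSpace Z] [TopologicalSpace T] {n : ℕ}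

theorem ContinuousMap.isStarProjection_iff {Y : Type*} [TopologicalSpace Y] {R : Type*} [Ring R]
    [StarRing R] [TopologicalSpace R] [IsTopologicalRing R] [ContinuousStar R] {f : C(Y, R)} :
    IsStarProjection f ↔ ∀ y, IsStarProjection (f y) := by
  simp only [_root_.isStarProjection_iff, IsIdempotentElem, IsSelfAdjoint, ContinuousMap.ext_iff,
    ContinuousMap.mul_apply, ContinuousMap.star_apply, forall_and]

/-- On an `ε`-dense set the values of `G` are projections, so every value of `G` is within `ε K` of
a projection and has a spectral cut. Comparing cuts at two points gives the Lipschitz bound as well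
as joint continuity. -/
theorem exists_spectralCut_extension {A : Type*} [CStarAlgebra A] {X : Set Z} {ε : ℝ}
    (hdense : IsEpsDense ε X) {K : ℝ≥0} (hε : 0 ≤ ε) (hK : ε * K < 1 / 2) (G : C(Z × T, A))
    (hGs : ∀ w, IsSelfAdjoint (G w)) (hGp : ∀ x ∈ X, ∀ t, IsStarProjection (G (x, t)))
    (hGL : ∀ t, LipschitzWith K fun z => G (z, t)) :
    ∃ Q : C(Z × T, A), (∀ w, IsSpectralCut (ε * K) (G w) (Q w)) ∧
      (∀ x ∈ X, ∀ t, Q (x, t) = G (x, t)) ∧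
      ∀ t, LipschitzWith (K * (1 - 2 * (ε * K))⁻¹).toNNReal fun z => Q (z, t) := by
  have hδ : 0 < 1 - 2 * (ε * K) := by linarith
  have hcut : ∀ w, ∃ p, IsSpectralCut (ε * K) (G w) p := by
    rintro ⟨z, t⟩
    obtain ⟨x, hx, hzx⟩ := hdense z
    refine exists_isSpectralCut hK (hGs _) (hGp x hx t) ?_
    rw [← dist_eq_norm, mul_comm]
    exact ((hGL t).dist_le_mul z x).trans (by gcongr)
  choose Q hQ using hcut
  have hQG : ∀ v w, dist (Q v) (Q w) ≤ (1 - 2 * (ε * K))⁻¹ * dist (G v) (G w) := fun v w => by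
    rw [dist_eq_norm, dist_eq_norm]; exact (hQ v).norm_sub_le hK (hQ w)
  have hcont : Continuous Q := by
    rw [continuous_iff_continuousAt]
    intro w
    rw [ContinuousAt, tendsto_iff_dist_tendsto_zero]
    refine squeeze_zero (fun _ => dist_nonneg) (fun v => hQG v w) ?_
    have : Continuous fun v => (1 - 2 * (ε * K))⁻¹ * dist (G v) (G w) := by fun_prop
    simpa using this.tendsto w
  refine ⟨⟨Q, hcont⟩, hQ, fun x hx t => ?_, fun t => LipschitzWith.of_dist_le_mul fun z w => ?_⟩
  · exact (hQ (x, t)).unique hK (isSpectralCut_self (by positivity) (hGp x hx t))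
  · rw [Real.coe_toNNReal _ (by positivity)]
    calc _ ≤ (1 - 2 * (ε * K))⁻¹ * dist (G (z, t)) (G (w, t)) := hQG _ _
      _ ≤ (1 - 2 * (ε * K))⁻¹ * (K * dist z w) := by
        gcongr; exact (hGL t).dist_le_mul z w
      _ = _ := by ring

/-- Averaging an extension with its conjugate makes it real. The spectral cut of a real matrix is
real because its conjugate is a cut of the same matrix, and cuts are unique. -/
theorem exists_projection_extension_real [CompactSpace Z] [CompactSpace T] {X : Set Z}
    (hX : IsClosed X) {ε : ℝ} (hε : 0 ≤ ε) (hdense : IsEpsDense ε X) {c N : ℝ≥0}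
    (hc : IsExtensionConstant n c) (hsmall : ε * (c * N : ℝ≥0) < 1 / 2)
    {p : T → C(X, Matrix (Fin n) (Fin n) ℝ)} (hp : Continuous p)
    (hpp : ∀ t, IsStarProjection (p t)) (hpL : ∀ t, LipschitzWith N (p t)) :
    ∃ q : T → C(Z, Matrix (Fin n) (Fin n) ℝ), Continuous q ∧ (∀ t, IsStarProjection (q t)) ∧
      (∀ t, (q t).restrict X = p t) ∧ ∀ t, LipschitzWith
        ((c * N : ℝ≥0) * (1 - 2 * (ε * (c * N : ℝ≥0)))⁻¹ : ℝ).toNNReal (q t) := by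
  simp only [ContinuousMap.isStarProjection_iff] at hpp ⊢
  let ι : C(Matrix (Fin n) (Fin n) ℝ, Matrix (Fin n) (Fin n) ℂ) :=
    ⟨matrixOfReal, isometry_matrixOfReal.continuous⟩
  have hιp : ∀ t x, IsStarProjection (ι (p t x)) := fun t x =>
    isStarProjection_matrixOfReal_iff.2 (hpp t x)
  obtain ⟨G, hGs, hGp, hGL⟩ := hc.exists_extension hX (p := fun t => ι.comp (p t))
    ((ContinuousMap.continuous_postcomp ι).comp hp) (fun t x => (hιp t x).isSelfAdjoint)
    (fun t => by
      have := isometry_matrixOfReal.lipschitz.comp (hpL t)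
      rwa [one_mul] at this)
  have hκ := (isometry_matrixConj (n := n)).continuous
  let H : C(Z × T, Matrix (Fin n) (Fin n) ℂ) :=
    ⟨fun w => (2⁻¹ : ℝ) • (G w + matrixConj (G w)), by fun_prop⟩
  have hH : ∀ w, H w = (2⁻¹ : ℝ) • (G w + matrixConj (G w)) := fun w => rfl
  have hHκ : ∀ w, matrixConj (H w) = H w := fun w => by
    rw [hH, matrixConj_real_smul, map_add, matrixConj_matrixConj, add_comm]
  have hHp : ∀ (x : X) t, H (x, t) = ι (p t x) := fun x t => by
    have h : G (x, t) = matrixOfReal (p t x) := hGp x t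
    rw [hH, h, matrixConj_matrixOfReal]
    change _ = matrixOfReal (p t x)
    module
  obtain ⟨Q, hQ, hQX, hQL⟩ := exists_spectralCut_extension hdense hε hsmall H
    (fun w => by
      rw [hH]
      refine (IsSelfAdjoint.all _).smul ((hGs w).add ?_)
      rw [IsSelfAdjoint, ← matrixConj_star, (hGs w).star_eq])
    (fun x hx t => by rw [hHp ⟨x, hx⟩]; exact hιp t _)
    (fun t => LipschitzWith.of_dist_le_mul fun z w => by
      have h1 := (hGL t).dist_le_mul z w
      have h2 : H (z, t) - H (w, t) = (2⁻¹ : ℝ) • ((G (z, t) - G (w, t)) +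
          matrixConj (G (z, t) - G (w, t))) := by rw [hH, hH, map_sub]; module
      have h3 := norm_add_le (G (z, t) - G (w, t)) (matrixConj (G (z, t) - G (w, t)))
      rw [norm_matrixConj] at h3
      rw [dist_eq_norm] at h1
      rw [dist_eq_norm, h2, norm_smul, norm_inv, Real.norm_ofNat]
      linarith)
  have hQκ : ∀ w, matrixConj (Q w) = Q w := fun w => by
    have := (hQ w).matrixConj
    rw [hHκ] at this
    exact this.unique hsmall (hQ w)
  have hQre : ∀ w, matrixOfReal ((Q w).map Complex.re) = Q w := fun w =>
    matrixOfReal_map_re (hQκ w)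
  let q : C(T × Z, Matrix (Fin n) (Fin n) ℝ) :=
    ⟨fun w => (Q (w.2, w.1)).map Complex.re,
      (by fun_prop : Continuous fun w : T × Z => Q (w.2, w.1)).matrix_map Complex.continuous_re⟩
  refine ⟨fun t => q.curry t, q.curry.continuous, fun t z => ?_, fun t => ?_, fun t => ?_⟩
  · rw [← isStarProjection_matrixOfReal_iff]
    exact (hQre (z, t)).symm ▸ (hQ (z, t)).isStarProjection
  · ext1 x
    refine matrixOfReal_injective ((hQre (x, t)).trans ?_)
    rw [hQX x x.2, hHp]; rfl
  · refine LipschitzWith.of_dist_le_mul fun z w => ?_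
    rw [← isometry_matrixOfReal.dist_eq]
    have := (hQL t).dist_le_mul z w
    rw [← hQre (z, t), ← hQre (w, t)] at this
    exact this

theorem exists_projection_extension_complex [CompactSpace Z] [CompactSpace T] {X : Set Z}
    (hX : IsClosed X) {ε : ℝ} (hε : 0 ≤ ε) (hdense : IsEpsDense ε X) {c N : ℝ≥0}
    (hc : IsExtensionConstant n c) (hsmall : ε * (c * N : ℝ≥0) < 1 / 2)
    {p : T → C(X, Matrix (Fin n) (Fin n) ℂ)} (hp : Continuous p)
    (hpp : ∀ t, IsStarProjection (p t)) (hpL : ∀ t, LipschitzWith N (p t)) :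
    ∃ q : T → C(Z, Matrix (Fin n) (Fin n) ℂ), Continuous q ∧ (∀ t, IsStarProjection (q t)) ∧
      (∀ t, (q t).restrict X = p t) ∧ ∀ t, LipschitzWith
        ((c * N : ℝ≥0) * (1 - 2 * (ε * (c * N : ℝ≥0)))⁻¹ : ℝ).toNNReal (q t) := by
  simp only [ContinuousMap.isStarProjection_iff] at hpp ⊢
  obtain ⟨G, hGs, hGp, hGL⟩ :=
    hc.exists_extension hX hp (fun t x => (hpp t x).isSelfAdjoint) hpL
  obtain ⟨Q, hQ, hQX, hQL⟩ := exists_spectralCut_extension hdense hε hsmall G hGs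
    (fun x hx t => by rw [hGp ⟨x, hx⟩]; exact hpp t _) hGL
  let q := (Q.comp ContinuousMap.prodSwap).curry
  refine ⟨fun t => q t, q.continuous, fun t z => (hQ (z, t)).isStarProjection, fun t => ?_, hQL⟩
  ext1 x
  exact (hQX x x.2 t).trans (hGp x t)

end Extension

/- `M_n(C(X))` is viewed as the algebra `C(X, M_n)` of continuous matrix-valued functions (with the
supremum norm, whose topology is the topology of `C(X, M_n)` since `X` is compact). -/
theorem theorem6p2 {Z : Type*} [MetricSpace Z] [CompactSpace Z]
    (X : Set Z) (hX : IsClosed X)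
    {T : Type*} [TopologicalSpace T] [CompactSpace T]
    (n : ℕ) (hn : 0 < n) (ε N : ℝ) (hε : 0 < ε) (hN : 0 < N)
    (hdense : IsEpsDense ε X)
    (hsmall : ε * extensionConstant n * N < 1 / 12) :
    (∀ p : T → C(X, Matrix (Fin n) (Fin n) ℂ),
      Continuous p → (∀ t, IsStarProjection (p t)) →
      (∀ t, lipSeminorm (p t) ≤ ENNReal.ofReal N) →
      ∃ q : T → C(Z, Matrix (Fin n) (Fin n) ℂ),
        Continuous q ∧ (∀ t, IsStarProjection (q t)) ∧
        (∀ t, (q t).restrict X = p t) ∧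
        ∀ t, lipSeminorm (q t) < ENNReal.ofReal
          (extensionConstant n * N * (1 - 12 * ε * extensionConstant n * N)⁻¹)) ∧
    (∀ p : T → C(X, Matrix (Fin n) (Fin n) ℝ),
      Continuous p → (∀ t, IsStarProjection (p t)) →
      (∀ t, lipSeminorm (p t) ≤ ENNReal.ofReal N) →
      ∃ q : T → C(Z, Matrix (Fin n) (Fin n) ℝ),
        Continuous q ∧ (∀ t, IsStarProjection (q t)) ∧
        (∀ t, (q t).restrict X = p t) ∧
        ∀ t, lipSeminorm (q t) < ENNReal.ofReal
          (extensionConstant n * N * (1 - 12 * ε * extensionConstant n * N)⁻¹)) := by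
  lift N to ℝ≥0 using hN.le
  set l := extensionConstant n with hl
  have hl1 : (1 : ℝ) ≤ l := one_le_extensionConstant hn
  set u : ℝ := ε * l * N with hu
  have hu0 : 0 < u := by positivity
  -- a constant slightly larger than the infimum, which need not be attained
  obtain ⟨c, hc⟩ : ∃ c : ℝ≥0, (c : ℝ) = l * (1 + u) := ⟨⟨l * (1 + u), by positivity⟩, rfl⟩
  have hlc : l < c := by
    rw [← NNReal.coe_lt_coe, hc]; nlinarith
  have hcE := isExtensionConstant_of_lt hlc
  have hcN : ε * (c * N : ℝ≥0) = u * (1 + u) := by rw [NNReal.coe_mul, hc, hu]; ring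
  have hsm : ε * (c * N : ℝ≥0) < 1 / 2 := by rw [hcN]; nlinarith
  have hbound : ((((c * N : ℝ≥0) * (1 - 2 * (ε * (c * N : ℝ≥0)))⁻¹ : ℝ).toNNReal : ℝ≥0) : ℝ≥0∞)
      < ENNReal.ofReal (l * N * (1 - 12 * ε * l * N)⁻¹) := by
    have h12 : 12 * ε * l * N = 12 * u := by rw [hu]; ring
    have h1 : 0 < 1 - 12 * u := by linarith
    have h2 : 0 < 1 - 2 * (u * (1 + u)) := by nlinarith
    have hlN : (0 : ℝ) < l * N := by positivity
    refine (ENNReal.ofReal_lt_ofReal_iff (by rw [h12]; positivity)).2 ?_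
    rw [hcN, h12, NNReal.coe_mul, hc, ← div_eq_mul_inv, ← div_eq_mul_inv, div_lt_div_iff₀ h2 h1]
    -- after cancelling `l * N` the claim is `(1 + u) * (1 - 10 * u) < 1`
    have : (1 + u) * (1 - 12 * u) < 1 - 2 * (u * (1 + u)) := by nlinarith
    nlinarith
  constructor
  · intro p hp hpp hpL
    obtain ⟨q, h1, h2, h3, h4⟩ := exists_projection_extension_complex hX hε.le hdense hcE hsm hp
      hpp fun t => lipSeminorm_le_iff.1 ((hpL t).trans_eq ENNReal.ofReal_coe_nnreal)
    exact ⟨q, h1, h2, h3, fun t => (lipSeminorm_le_iff.2 (h4 t)).trans_lt hbound⟩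
  · intro p hp hpp hpL
    obtain ⟨q, h1, h2, h3, h4⟩ := exists_projection_extension_real hX hε.le hdense hcE hsm hp
      hpp fun t => lipSeminorm_le_iff.1 ((hpL t).trans_eq ENNReal.ofReal_coe_nnreal)
    exact ⟨q, h1, h2, h3, fun t => (lipSeminorm_le_iff.2 (h4 t)).trans_lt hbound⟩
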